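/- Let $\delta>0$ and let $X_1,X_2,\dots$ be independent, identically distributed real random variables with $\mathbb{E}[X_i]=0$, $\operatorname{Var}[X_i]=1$ and $\mathbb{E}\big[|X_i|^{2(1+\delta)}\big]<\infty$. Let $B$ be any constant with $\frac{B}{576}\left(1-\frac{1}{1+\delta}\right)-1>1$. An interval of $[N]=\{1,\dots,N\}$ is a set $I=\{a+1,\dots,b\}$ with integers $0\le a\le b\le N$; write $|I|=b-a$ and $S_I=\sum_{i\in I}X_i$. Let $\mathcal{P}_N$ be the set of all partitions of $[N]$ into nonempty intervals, put \[\big\|\{X_i\}^N\big\|_{V^2}=\Big(\max_{\pi\in\mathcal{P}_N}\sum_{I\in\pi}S_I^2\Big)^{1/2},\] and call $\pi\in\mathcal{P}_N$ maximal if $\sum_{I\in\pi}S_I^2=\big\|\{X_i\}^N\big\|_{V^2}^2$. Then almost surely the following holds: for every choice of a maximal partition $\pi_N\in\mathcal{P}_N$ for each $N$, the contribution \[\mathcal{B}_N=\sum_{\substack{I\in\pi_N\\ S_I^2>B|I|\ln\ln N}}S_I^2\] of the bad intervals to $\big\|\{X_i\}^N\big\|_{V^2}^2$ satisfies \[\frac{\mathcal{B}_N}{N\ln\ln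 N}\longrightarrow 0\qquad\text{as } N\to\infty.\] -/

import Mathlib

open MeasureTheory ProbabilityTheory Filter Topology

/-- The partitions of `[N]` into (nonempty) intervals. Sequences are indexed from `0`, so `[N]` is
modelled by `Finset.range N = {0, …, N - 1}`, and `Finset.Ico a b` is the interval of the
`a+1`-st to the `b`-th terms, of length `b - a`. -/
abbrev IntervalPartition (N : ℕ) : Type :=
  {π : Finpartition (Finset.range N) // ∀ I ∈ π.parts, ∃ a b : ℕ, I = Finset.Ico a b}

/-- `S_I = ∑_{i ∈ I} x_i`. -/
def intervalSum (x : ℕ → ℝ) (I : Finset ℕ) : ℝ := ∑ i ∈ I, x i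

/-- `∑_{I ∈ π} S_I ^ 2`. -/
def squareSum (x : ℕ → ℝ) {N : ℕ} (π : IntervalPartition N) : ℝ :=
  ∑ I ∈ π.1.parts, intervalSum x I ^ 2

/-- The square variation norm of the first `N` terms of `x`: the square root of the maximum of
`∑_{I ∈ π} S_I ^ 2` over all partitions `π` of `[N]` into intervals. -/
noncomputable def squareVariation (x : ℕ → ℝ) (N : ℕ) : ℝ :=
  √(⨆ π : IntervalPartition N, squareSum x π)

/-- `π` is a maximal partition of `[N]`: one at which the square variation is attained. -/
def IsMaximalPartition (x : ℕ → ℝ) {N : ℕ} (π : IntervalPartition N) : Prop :=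
  squareSum x π = squareVariation x N ^ 2

open Classical in
/-- The contribution to `∑_{I ∈ π} S_I ^ 2` of the bad intervals of `π`, that is of those with
`S_I ^ 2 > B |I| ln ln N`. -/
noncomputable def badContribution (B : ℝ) (x : ℕ → ℝ) {N : ℕ} (π : IntervalPartition N) : ℝ :=
  ∑ I ∈ π.1.parts with
    intervalSum x I ^ 2 > B * (I.card : ℝ) * Real.log (Real.log (N : ℝ)),
    intervalSum x I ^ 2

instance (N : ℕ) : Nonempty (IntervalPartition N) :=
  ⟨⊥, fun I hI => by
    obtain ⟨a, -, rfl⟩ := Finpartition.mem_bot_iff.1 hI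
    exact ⟨a, a + 1, by ext; simp⟩⟩

/-- A maximal partition always exists. -/
theorem exists_isMaximalPartition (x : ℕ → ℝ) (N : ℕ) :
    ∃ π : IntervalPartition N, IsMaximalPartition x π := by
  obtain ⟨π, hπ⟩ := exists_eq_ciSup_of_finite (f := fun π : IntervalPartition N => squareSum x π)
  refine ⟨π, ?_⟩
  have h0 : 0 ≤ squareSum x π := Finset.sum_nonneg fun _ _ => sq_nonneg _
  rw [IsMaximalPartition, squareVariation, ← hπ, Real.sq_sqrt h0]

/-! Almost surely the bad intervals contribute only `O(N)`, for every interval partition at once;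
dividing by `N ln ln N` then gives the limit. Put `p = 2(1+δ) > 2`.

Take a bad interval with `2^k ≤ |I| < 2^(k+1)` that starts in the dyadic block `[q 2^k, (q+1) 2^k)`.
It lies in the block of length `3 * 2^k` starting at `q 2^k`, and disjoint intervals have distinct
pairs `(k, q)` (`sum_parts_le_sum_blocks`). Truncate the terms at `2^(k/p)`. Then `S_I^2` is at most
16 times a functional of that block, `blockMajorant`: the squared maximal partial sum of the centred
truncated terms where it exceeds a threshold of order `√(B 2^k ln ln 2^k)`, plus the squared total
of the remainders (`intervalSum_sq_le`).

In expectation the first summand is `O(2^k k^(-5))`, by an exponential maximal inequality and the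
size of `B`; the second is `O(2^(2k/p))`, by the `p`-th moment. Both are summable against the
weights `2^k/(k+1)^2` (`summable_integral_blockMajorant`).

For fixed `k`, the sum over `q` is a Birkhoff sum for the shift by `2^k`. The weak type bound of the
maximal ergodic theorem and a union bound over `k` give one random `C` such that the first `n`
blocks of level `k` total at most `C n 2^k/(k+1)^2`, for all `k` and `n`
(`ae_exists_forall_birkhoffSum_le`). With about `N/2^k` blocks per level, summing over `k` yields
`O(N)`. -/

/-! ### Maximal ergodic theorem and its weak type bound. -/

section MaximalErgodic

variable {α : Type*} {T : α → α} {f : α → ℝ}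

/-- The maximum of the first `n` Birkhoff sums, the empty one included. -/
noncomputable def birkhoffMax (T : α → α) (f : α → ℝ) (n : ℕ) (x : α) : ℝ :=
  (Finset.range (n + 1)).sup' Finset.nonempty_range_add_one fun m => birkhoffSum T f m x

theorem birkhoffSum_le_birkhoffMax (T : α → α) (f : α → ℝ) {m n : ℕ} (h : m ≤ n) (x : α) :
    birkhoffSum T f m x ≤ birkhoffMax T f n x :=
  Finset.le_sup' (fun m => birkhoffSum T f m x) (Finset.mem_range.2 (Nat.lt_succ_of_le h))

theorem birkhoffMax_nonneg (T : α → α) (f : α → ℝ) (n : ℕ) (x : α) : 0 ≤ birkhoffMax T f n x := by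
  simpa using birkhoffSum_le_birkhoffMax T f (Nat.zero_le n) x

theorem lt_birkhoffMax_iff {n : ℕ} {x : α} {c : ℝ} :
    c < birkhoffMax T f n x ↔ ∃ m ≤ n, c < birkhoffSum T f m x := by
  simp [birkhoffMax, Finset.lt_sup'_iff]

/-- A positive maximum is not attained by the empty sum, so a first term can be split off; the rest
is a Birkhoff sum from `T x`. -/
theorem birkhoffMax_le_add {n : ℕ} {x : α} (h : 0 < birkhoffMax T f n x) :
    birkhoffMax T f n x ≤ f x + birkhoffMax T f n (T x) := by
  obtain ⟨m, hm, hmax⟩ := Finset.exists_mem_eq_sup' (Finset.nonempty_range_add_one (n := n))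
    fun m => birkhoffSum T f m x
  change birkhoffMax T f n x = _ at hmax
  have hmn : m ≤ n := Nat.lt_succ_iff.1 (Finset.mem_range.1 hm)
  rcases m with _ | m
  · simp [hmax] at h
  · rw [hmax, birkhoffSum_succ']
    gcongr
    exact birkhoffSum_le_birkhoffMax T f (by lia) (T x)

theorem birkhoffSum_sub_const (T : α → α) (f : α → ℝ) (c : ℝ) (n : ℕ) (x : α) :
    birkhoffSum T (fun x => f x - c) n x = birkhoffSum T f n x - c * n := by
  simp [birkhoffSum, Finset.sum_sub_distrib, mul_comm]

variable [MeasurableSpace α] {μ : Measure α}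

theorem integrable_birkhoffSum (hT : MeasurePreserving T μ μ) (hf : Integrable f μ) (n : ℕ) :
    Integrable (birkhoffSum T f n) μ := by
  have : birkhoffSum T f n = fun x => ∑ k ∈ Finset.range n, f (T^[k] x) := rfl
  rw [this]
  exact integrable_finsetSum _ fun k _ => (hT.iterate k).integrable_comp_of_integrable hf

theorem measurable_birkhoffSum (hT : Measurable T) (hf : Measurable f) (n : ℕ) :
    Measurable (birkhoffSum T f n) :=
  Finset.measurable_fun_sum _ fun k _ => hf.comp (hT.iterate k)

theorem measurable_birkhoffMax (hT : Measurable T) (hf : Measurable f) (n : ℕ) :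
    Measurable (birkhoffMax T f n) :=
  Finset.measurable_range_sup'' fun k _ => measurable_birkhoffSum hT hf k

theorem integrable_birkhoffMax (hT : MeasurePreserving T μ μ) (hfm : Measurable f)
    (hf : Integrable f μ) (n : ℕ) : Integrable (birkhoffMax T f n) μ := by
  refine Integrable.mono' (g := fun x => ∑ m ∈ Finset.range (n + 1), |birkhoffSum T f m x|)
    (integrable_finsetSum _ fun m _ => (integrable_birkhoffSum hT hf m).abs)
    (measurable_birkhoffMax hT.measurable hfm n).aestronglyMeasurable (.of_forall fun x => ?_)
  rw [Real.norm_eq_abs, abs_of_nonneg (birkhoffMax_nonneg T f n x)]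
  refine Finset.sup'_le _ _ fun m hm => (le_abs_self _).trans ?_
  exact Finset.single_le_sum (f := fun m => |birkhoffSum T f m x|) (fun _ _ => abs_nonneg _) hm

/-- The maximal ergodic theorem. -/
theorem setIntegral_birkhoffMax_pos_nonneg (hT : MeasurePreserving T μ μ) (hfm : Measurable f)
    (hf : Integrable f μ) (n : ℕ) : 0 ≤ ∫ x in {x | 0 < birkhoffMax T f n x}, f x ∂μ := by
  set E := {x | 0 < birkhoffMax T f n x}
  have hE : MeasurableSet E :=
    measurableSet_lt measurable_const (measurable_birkhoffMax hT.measurable hfm n)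
  have hM := integrable_birkhoffMax hT hfm hf n
  have hMT : Integrable (fun x => birkhoffMax T f n (T x)) μ := hT.integrable_comp_of_integrable hM
  -- Garsia's argument: integrate `M ≤ f + M ∘ T` over `E`. As `M` vanishes off `E` and `T`
  -- preserves `μ`, the `M` terms cancel in the favourable direction.
  have h1 : ∫ x in E, birkhoffMax T f n x ∂μ = ∫ x, birkhoffMax T f n x ∂μ :=
    setIntegral_eq_integral_of_forall_compl_eq_zero fun x hx =>
      le_antisymm (not_lt.1 hx) (birkhoffMax_nonneg T f n x)
  have h2 : ∫ x in E, birkhoffMax T f n (T x) ∂μ ≤ ∫ x, birkhoffMax T f n (T x) ∂μ :=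
    setIntegral_le_integral hMT (.of_forall fun x => birkhoffMax_nonneg T f n (T x))
  have h3 : ∫ x, birkhoffMax T f n (T x) ∂μ = ∫ x, birkhoffMax T f n x ∂μ := by
    conv_rhs => rw [← hT.map_eq]
    rw [integral_map hT.measurable.aemeasurable
      (measurable_birkhoffMax hT.measurable hfm n).aestronglyMeasurable]
  have h4 : ∫ x in E, birkhoffMax T f n x ∂μ ≤ ∫ x in E, (f x + birkhoffMax T f n (T x)) ∂μ :=
    setIntegral_mono_on hM.integrableOn (hf.add hMT).integrableOn hE
      fun x hx => birkhoffMax_le_add hx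
  rw [integral_add hf.integrableOn hMT.integrableOn] at h4
  linarith

/-- The weak type `(1, 1)` bound for the maximal function of the Birkhoff averages. -/
theorem measure_exists_lt_birkhoffSum_le [IsFiniteMeasure μ] (hT : MeasurePreserving T μ μ)
    (hfm : Measurable f) (hf : Integrable f μ) (hf0 : 0 ≤ f) {c : ℝ} (hc : 0 < c) :
    μ {x | ∃ n : ℕ, c * n < birkhoffSum T f n x} ≤ ENNReal.ofReal ((∫ x, f x ∂μ) / c) := by
  have hfin : ∀ n, μ {x | 0 < birkhoffMax T (fun x => f x - c) n x} ≤
      ENNReal.ofReal ((∫ x, f x ∂μ) / c) := by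
    intro n
    set E := {x | 0 < birkhoffMax T (fun x => f x - c) n x}
    have h := setIntegral_birkhoffMax_pos_nonneg hT (hfm.sub_const c)
      (hf.sub (integrable_const c)) n
    rw [integral_sub hf.integrableOn (integrable_const c).integrableOn, setIntegral_const,
      smul_eq_mul] at h
    have h2 : ∫ x in E, f x ∂μ ≤ ∫ x, f x ∂μ := setIntegral_le_integral hf (.of_forall hf0)
    rw [← ofReal_measureReal]
    refine ENNReal.ofReal_le_ofReal ?_
    rw [le_div_iff₀ hc]
    change 0 ≤ _ - μ.real E * c at h
    linarith
  have hU : {x | ∃ n : ℕ, c * n < birkhoffSum T f n x} =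
      ⋃ n, {x | 0 < birkhoffMax T (fun x => f x - c) n x} := by
    ext x
    simp only [Set.mem_ofPred_eq, Set.mem_iUnion, lt_birkhoffMax_iff, birkhoffSum_sub_const, sub_pos]
    exact ⟨fun ⟨n, hn⟩ => ⟨n, n, le_rfl, hn⟩, fun ⟨_, m, _, hm⟩ => ⟨m, hm⟩⟩
  have hmono : Monotone fun n => {x | 0 < birkhoffMax T (fun x => f x - c) n x} := by
    intro m n hmn x hx
    simp only [Set.mem_ofPred_eq, lt_birkhoffMax_iff] at hx ⊢
    obtain ⟨l, hl, h⟩ := hx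
    exact ⟨l, hl.trans hmn, h⟩
  rw [hU, hmono.measure_iUnion]
  exact iSup_le hfin

/-- Simultaneous bounds for the Birkhoff sums of countably many functions. -/
theorem ae_exists_forall_birkhoffSum_le [IsFiniteMeasure μ] {T : ℕ → α → α} {f : ℕ → α → ℝ}
    {w : ℕ → ℝ} (hT : ∀ k, MeasurePreserving (T k) μ μ) (hfm : ∀ k, Measurable (f k))
    (hf : ∀ k, Integrable (f k) μ) (hf0 : ∀ k, 0 ≤ f k) (hw : ∀ k, 0 < w k)
    (hsum : Summable fun k => (∫ x, f k x ∂μ) / w k) :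
    ∀ᵐ x ∂μ, ∃ C : ℝ, 0 ≤ C ∧ ∀ k n : ℕ, birkhoffSum (T k) (f k) n x ≤ C * w k * n := by
  have hbound : ∀ c : ℕ, μ {x | ¬ ∃ C : ℝ, 0 ≤ C ∧ ∀ k n : ℕ,
      birkhoffSum (T k) (f k) n x ≤ C * w k * n} ≤
      ENNReal.ofReal ((∑' k, (∫ x, f k x ∂μ) / w k) / ((c : ℝ) + 1)) := by
    intro c
    have hc : (0 : ℝ) < (c : ℝ) + 1 := by positivity
    -- If no constant works then `c + 1` fails at some `k`; the union bound over `k` costs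
    -- `O(1/(c+1))`, and `c` is arbitrary.
    calc _ ≤ μ (⋃ k, {x | ∃ n : ℕ, (((c : ℝ) + 1) * w k) * n < birkhoffSum (T k) (f k) n x}) := by
          refine measure_mono fun x hx => ?_
          simp only [Set.mem_ofPred_eq, not_exists, not_and, not_forall, not_le] at hx
          obtain ⟨k, n, h⟩ := hx ((c : ℝ) + 1) hc.le
          exact Set.mem_iUnion.2 ⟨k, n, h⟩
      _ ≤ ∑' k, μ {x | ∃ n : ℕ, (((c : ℝ) + 1) * w k) * n < birkhoffSum (T k) (f k) n x} :=
          measure_iUnion_le _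
      _ ≤ ∑' k, ENNReal.ofReal ((∫ x, f k x ∂μ) / (((c : ℝ) + 1) * w k)) :=
          ENNReal.tsum_le_tsum fun k =>
            measure_exists_lt_birkhoffSum_le (hT k) (hfm k) (hf k) (hf0 k) (mul_pos hc (hw k))
      _ = ENNReal.ofReal ((∑' k, (∫ x, f k x ∂μ) / w k) / ((c : ℝ) + 1)) := by
          have he : ∀ k, (∫ x, f k x ∂μ) / (((c : ℝ) + 1) * w k) =
              (∫ x, f k x ∂μ) / w k / ((c : ℝ) + 1) := fun k => by
            rw [div_div, mul_comm]
          simp only [he]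
          rw [← tsum_div_const, ENNReal.ofReal_tsum_of_nonneg _ (hsum.div_const _)]
          exact fun k => div_nonneg (div_nonneg (integral_nonneg (hf0 k)) (hw k).le) hc.le
  have hlim : Tendsto (fun c : ℕ =>
      ENNReal.ofReal ((∑' k, (∫ x, f k x ∂μ) / w k) / ((c : ℝ) + 1))) atTop (𝓝 0) := by
    rw [← ENNReal.ofReal_zero]
    refine (ENNReal.continuous_ofReal.tendsto 0).comp ?_
    exact (tendsto_const_nhds (x := ∑' k, (∫ x, f k x ∂μ) / w k)).div_atTop
      (tendsto_atTop_add_const_right _ _ tendsto_natCast_atTop_atTop)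
  exact le_antisymm (ge_of_tendsto' hlim hbound) zero_le

end MaximalErgodic

/-! ### Exponential maximal inequality for bounded centred steps. -/

section ExponentialMaximal

variable {Ω : Type*} [MeasurableSpace Ω] {μ : Measure Ω}

theorem integrable_of_measurable_of_abs_le [IsFiniteMeasure μ] {f : Ω → ℝ} (hf : Measurable f)
    {K : ℝ} (h : ∀ ω, |f ω| ≤ K) : Integrable f μ :=
  Integrable.of_bound hf.aestronglyMeasurable K (.of_forall h)

theorem mgf_le_exp_sq [IsProbabilityMeasure μ] {Y : Ω → ℝ} (hY : Measurable Y) {K : ℝ}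
    (hK : ∀ ω, |Y ω| ≤ K) (h0 : ∫ ω, Y ω ∂μ = 0) (h2 : ∫ ω, Y ω ^ 2 ∂μ ≤ 1) {l : ℝ}
    (hl : |l| * K ≤ 1) : mgf Y μ l ≤ Real.exp (l ^ 2) := by
  have hYi : Integrable Y μ := integrable_of_measurable_of_abs_le hY hK
  have hY2 : Integrable (fun ω => Y ω ^ 2) μ :=
    integrable_of_measurable_of_abs_le (hY.pow_const 2) (K := K ^ 2) fun ω => by
      rw [abs_pow]
      exact pow_le_pow_left₀ (abs_nonneg _) (hK ω) 2
  have hb : ∀ ω, |l * Y ω| ≤ 1 := fun ω => by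
    rw [abs_mul]
    exact (mul_le_mul_of_nonneg_left (hK ω) (abs_nonneg l)).trans hl
  have hpt : ∀ ω, Real.exp (l * Y ω) ≤ 1 + l * Y ω + l ^ 2 * Y ω ^ 2 := fun ω => by
    have := (abs_le.1 (Real.abs_exp_sub_one_sub_id_le (hb ω))).2
    nlinarith
  have hexp : Integrable (fun ω => Real.exp (l * Y ω)) μ :=
    integrable_of_measurable_of_abs_le (by fun_prop) (K := Real.exp 1) fun ω => by
      rw [Real.abs_exp]
      exact Real.exp_le_exp.2 ((le_abs_self _).trans (hb ω))
  calc mgf Y μ l ≤ ∫ ω, (1 + l * Y ω + l ^ 2 * Y ω ^ 2) ∂μ :=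
        integral_mono hexp (((integrable_const 1).add (hYi.const_mul l)).add (hY2.const_mul _)) hpt
    _ = 1 + l ^ 2 * ∫ ω, Y ω ^ 2 ∂μ := by
        have hlin : Integrable (fun ω => 1 + l * Y ω) μ :=
          (integrable_const 1).add (hYi.const_mul l)
        rw [integral_add hlin (hY2.const_mul _),
          integral_add (integrable_const 1) (hYi.const_mul l), integral_const_mul,
          integral_const_mul, h0]
        simp
    _ ≤ l ^ 2 + 1 := by nlinarith [sq_nonneg l]
    _ ≤ Real.exp (l ^ 2) := Real.add_one_le_exp _

variable {Y : ℕ → Ω → ℝ} {K : ℝ}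

/-- The exponential of a random walk with bounded centred steps is a submartingale. -/
theorem submartingale_exp_sum [IsProbabilityMeasure μ] (hY : ∀ i, Measurable (Y i))
    (hind : iIndepFun Y μ) (hK : ∀ i ω, |Y i ω| ≤ K) (h0 : ∀ i, ∫ ω, Y i ω ∂μ = 0) (l : ℝ) :
    Submartingale (fun m ω => Real.exp (l * ∑ i ∈ Finset.range (m + 1), Y i ω))
      (Filtration.natural Y fun i => (hY i).stronglyMeasurable) μ := by
  set ℱ := Filtration.natural Y fun i => (hY i).stronglyMeasurable
  have hadY : ∀ {i m}, i ≤ m → Measurable[ℱ m] (Y i) := fun {i m} him =>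
    ((Filtration.stronglyAdapted_natural fun i => (hY i).stronglyMeasurable) i).measurable.mono
      (ℱ.mono him) le_rfl
  have hadp : StronglyAdapted ℱ fun m ω => Real.exp (l * ∑ i ∈ Finset.range (m + 1), Y i ω) := by
    intro m
    refine Measurable.stronglyMeasurable (Measurable.exp (Measurable.const_mul ?_ l))
    exact Finset.measurable_fun_sum _ fun i hi => hadY (by simpa [Nat.lt_succ_iff] using hi)
  have hstep : ∀ m ω, |l * Y m ω| ≤ |l| * K := fun m ω => by
    rw [abs_mul]
    exact mul_le_mul_of_nonneg_left (hK m ω) (abs_nonneg l)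
  have hexp : ∀ m, Integrable (fun ω => Real.exp (l * Y m ω)) μ := fun m =>
    integrable_of_measurable_of_abs_le (by fun_prop) (K := Real.exp (|l| * K)) fun ω => by
      rw [Real.abs_exp]
      exact Real.exp_le_exp.2 ((le_abs_self _).trans (hstep m ω))
  have hint : ∀ m, Integrable (fun ω => Real.exp (l * ∑ i ∈ Finset.range (m + 1), Y i ω)) μ :=
    fun m => integrable_of_measurable_of_abs_le (by fun_prop)
      (K := Real.exp (∑ i ∈ Finset.range (m + 1), |l| * K)) fun ω => by
      rw [Real.abs_exp, Finset.mul_sum]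
      exact Real.exp_le_exp.2
        (Finset.sum_le_sum fun i _ => (le_abs_self _).trans (hstep i ω))
  refine submartingale_nat hadp hint fun m => ?_
  have hsplit : (fun ω => Real.exp (l * ∑ i ∈ Finset.range (m + 1 + 1), Y i ω)) =
      (fun ω => Real.exp (l * ∑ i ∈ Finset.range (m + 1), Y i ω)) *
        fun ω => Real.exp (l * Y (m + 1) ω) := by
    ext ω
    simp only [Pi.mul_apply]
    rw [Finset.sum_range_succ, mul_add, Real.exp_add]
  have h1 : μ[fun ω => Real.exp (l * Y (m + 1) ω) | ℱ m] =ᵐ[μ]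
      fun _ => ∫ ω, Real.exp (l * Y (m + 1) ω) ∂μ :=
    condExp_indep_eq (hY (m + 1)).comap_le (ℱ.le m)
      (((comap_measurable (Y (m + 1))).const_mul l).exp.stronglyMeasurable)
      (hind.indep_comap_natural_of_lt (fun i => (hY i).stronglyMeasurable) (Nat.lt_succ_self m))
  -- From `1 + u ≤ exp u` and centring: the independent new factor has mean at least 1.
  have h2 : 1 ≤ ∫ ω, Real.exp (l * Y (m + 1) ω) ∂μ := by
    have hYi : Integrable (Y (m + 1)) μ := integrable_of_measurable_of_abs_le (hY _) (hK _)
    calc (1 : ℝ) = ∫ ω, (l * Y (m + 1) ω + 1) ∂μ := by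
          rw [integral_add (hYi.const_mul l) (integrable_const 1), integral_const_mul, h0]
          simp
      _ ≤ _ := integral_mono ((hYi.const_mul l).add (integrable_const 1)) (hexp _)
          fun ω => Real.add_one_le_exp _
  have h3 := condExp_mul_of_stronglyMeasurable_left (hadp m) (hsplit ▸ hint (m + 1)) (hexp (m + 1))
  rw [hsplit]
  filter_upwards [h1, h3] with ω h1 h3
  rw [h3, Pi.mul_apply, h1]
  exact le_mul_of_one_le_right (Real.exp_pos _).le h2

/-- Doob's maximal inequality for the exponential submartingale, whose last term has mean at most
`exp (n l^2)` by independence and `mgf_le_exp_sq`. The parameter `l` stays free, to be optimised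
later. -/
theorem measure_exists_le_sum_le [IsProbabilityMeasure μ] (hY : ∀ i, Measurable (Y i))
    (hind : iIndepFun Y μ) (hK : ∀ i ω, |Y i ω| ≤ K) (h0 : ∀ i, ∫ ω, Y i ω ∂μ = 0)
    (h2 : ∀ i, ∫ ω, Y i ω ^ 2 ∂μ ≤ 1) {l u : ℝ} (hl0 : 0 ≤ l) (hl : l * K ≤ 1) (hu : 0 < u)
    (n : ℕ) :
    μ {ω | ∃ m ≤ n, u ≤ ∑ i ∈ Finset.range m, Y i ω} ≤
      ENNReal.ofReal (Real.exp (n * l ^ 2 - l * u)) := by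
  rcases n with _ | n
  · have : {ω | ∃ m ≤ 0, u ≤ ∑ i ∈ Finset.range m, Y i ω} = ∅ := by
      ext ω
      simp [hu]
    rw [this, measure_empty]
    exact zero_le
  set f : ℕ → Ω → ℝ := fun m ω => Real.exp (l * ∑ i ∈ Finset.range (m + 1), Y i ω) with hf
  have hsub : Submartingale f _ μ := submartingale_exp_sum hY hind hK h0 l
  have hmax := maximal_ineq hsub (fun m ω => (Real.exp_pos _).le)
    (ε := (Real.exp (l * u)).toNNReal) n
  rw [Real.coe_toNNReal _ (Real.exp_pos _).le] at hmax
  set A := {ω | Real.exp (l * u) ≤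
    (Finset.range (n + 1)).sup' Finset.nonempty_range_add_one fun k => f k ω}
  have hle : {ω | ∃ m ≤ n + 1, u ≤ ∑ i ∈ Finset.range m, Y i ω} ⊆ A := by
    rintro ω ⟨m, hm, hum⟩
    rcases m with _ | m
    · simp at hum
      linarith
    · have hmn : m ∈ Finset.range (n + 1) := Finset.mem_range.2 (by lia)
      change Real.exp (l * u) ≤ (Finset.range (n + 1)).sup' _ _
      refine (Finset.le_sup'_iff _).2 ⟨m, hmn, ?_⟩
      exact Real.exp_le_exp.2 (mul_le_mul_of_nonneg_left hum hl0)
  have hA : ∫ ω in A, f n ω ∂μ ≤ Real.exp (((n + 1 : ℕ) : ℝ) * l ^ 2) := by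
    calc ∫ ω in A, f n ω ∂μ ≤ ∫ ω, f n ω ∂μ :=
          setIntegral_le_integral (hsub.integrable n) (.of_forall fun ω => (Real.exp_pos _).le)
      _ = mgf (∑ i ∈ Finset.range (n + 1), Y i) μ l := by simp [mgf, hf]
      _ = ∏ i ∈ Finset.range (n + 1), mgf (Y i) μ l := hind.mgf_sum hY _
      _ ≤ ∏ i ∈ Finset.range (n + 1), Real.exp (l ^ 2) :=
          Finset.prod_le_prod (fun i _ => mgf_nonneg) fun i _ =>
            mgf_le_exp_sq (hY i) (hK i) (h0 i) (h2 i) (by rwa [abs_of_nonneg hl0])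
      _ = Real.exp (((n + 1 : ℕ) : ℝ) * l ^ 2) := by
          rw [Finset.prod_const, Finset.card_range, ← Real.exp_nat_mul]
  have hfin : ENNReal.ofReal (Real.exp (l * u)) * μ A ≤
      ENNReal.ofReal (Real.exp (((n + 1 : ℕ) : ℝ) * l ^ 2)) :=
    hmax.trans (ENNReal.ofReal_le_ofReal hA)
  refine (measure_mono hle).trans ?_
  rw [Real.exp_sub, ENNReal.ofReal_div_of_pos (Real.exp_pos _),
    ENNReal.le_div_iff_mul_le (.inl (by simp [Real.exp_pos])) (.inl ENNReal.ofReal_ne_top), mul_comm]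
  exact hfin

/-- The largest absolute value of the first `n` partial sums of a sequence. -/
noncomputable def partialSumMax (n : ℕ) (z : ℕ → ℝ) : ℝ :=
  (Finset.range (n + 1)).sup' Finset.nonempty_range_add_one fun m => |∑ i ∈ Finset.range m, z i|

theorem abs_sum_le_partialSumMax {m n : ℕ} (h : m ≤ n) (z : ℕ → ℝ) :
    |∑ i ∈ Finset.range m, z i| ≤ partialSumMax n z :=
  Finset.le_sup' (fun m => |∑ i ∈ Finset.range m, z i|) (Finset.mem_range.2 (Nat.lt_succ_of_le h))

theorem partialSumMax_nonneg (n : ℕ) (z : ℕ → ℝ) : 0 ≤ partialSumMax n z := by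
  simpa using abs_sum_le_partialSumMax (Nat.zero_le n) z

theorem partialSumMax_le {n : ℕ} {z : ℕ → ℝ} {K : ℝ} (h : ∀ i, |z i| ≤ K) : partialSumMax n z ≤ n * K := by
  have hK : 0 ≤ K := (abs_nonneg _).trans (h 0)
  refine Finset.sup'_le _ _ fun m hm => ?_
  calc |∑ i ∈ Finset.range m, z i| ≤ ∑ i ∈ Finset.range m, |z i| := Finset.abs_sum_le_sum_abs _ _
    _ ≤ ∑ i ∈ Finset.range m, K := Finset.sum_le_sum fun i _ => h i
    _ = m * K := by simp
    _ ≤ n * K := by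
        gcongr
        exact Nat.lt_succ_iff.1 (Finset.mem_range.1 hm)

theorem measurable_partialSumMax (n : ℕ) : Measurable (partialSumMax n) :=
  Finset.measurable_range_sup'' fun k _ => by fun_prop

theorem measure_le_partialSumMax_le [IsProbabilityMeasure μ] (hY : ∀ i, Measurable (Y i))
    (hind : iIndepFun Y μ) (hK : ∀ i ω, |Y i ω| ≤ K) (h0 : ∀ i, ∫ ω, Y i ω ∂μ = 0)
    (h2 : ∀ i, ∫ ω, Y i ω ^ 2 ∂μ ≤ 1) {l u : ℝ} (hl0 : 0 ≤ l) (hl : l * K ≤ 1) (hu : 0 < u)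
    (n : ℕ) :
    μ {ω | u ≤ partialSumMax n fun i => Y i ω} ≤
      ENNReal.ofReal (2 * Real.exp (n * l ^ 2) * Real.exp (-(l * u))) := by
  have hpos := measure_exists_le_sum_le hY hind hK h0 h2 hl0 hl hu n
  have hneg := measure_exists_le_sum_le (Y := fun i ω => -Y i ω) (fun i => (hY i).neg)
    (hind.comp (fun _ x => -x) fun _ => measurable_neg) (fun i ω => by simpa using hK i ω)
    (fun i => by simp [integral_neg, h0]) (fun i => by simpa using h2 i) hl0 hl hu n
  have hle : {ω | u ≤ partialSumMax n fun i => Y i ω} ⊆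
      {ω | ∃ m ≤ n, u ≤ ∑ i ∈ Finset.range m, Y i ω} ∪
        {ω | ∃ m ≤ n, u ≤ ∑ i ∈ Finset.range m, -Y i ω} := by
    intro ω hω
    obtain ⟨m, hm, h⟩ := (Finset.le_sup'_iff _).1 (show u ≤ partialSumMax n fun i => Y i ω from hω)
    have hm' : m ≤ n := Nat.lt_succ_iff.1 (Finset.mem_range.1 hm)
    rcases le_abs.1 h with h | h
    · exact .inl ⟨m, hm', h⟩
    · exact .inr ⟨m, hm', by rwa [Finset.sum_neg_distrib]⟩
  calc _ ≤ _ := measure_mono hle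
    _ ≤ _ := measure_union_le _ _
    _ ≤ _ := add_le_add hpos hneg
    _ = _ := by
        rw [← ENNReal.ofReal_add (Real.exp_pos _).le (Real.exp_pos _).le, sub_eq_add_neg,
          Real.exp_add]
        ring_nf

theorem summable_succ_sq_mul_exp_neg :
    Summable fun r : ℕ => 4 * ((r : ℝ) + 1) ^ 2 * Real.exp (-r) := by
  have h := (summable_nat_add_iff 1).2 (Real.summable_pow_mul_exp_neg_nat_mul 2 one_pos)
  refine (h.mul_left (4 * Real.exp 1)).congr fun r => ?_
  push_cast
  rw [show (-1 * ((r : ℝ) + 1)) = -r + -1 by ring, Real.exp_add, Real.exp_neg 1]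
  field_simp

/-- Exponential tails bound the truncated second moment. -/
theorem integral_indicator_sq_le_of_exp_tail [IsFiniteMeasure μ] {g : Ω → ℝ}
    (hg : Measurable g) {t A a : ℝ} (ht : 0 < t) (hA : 0 ≤ A) (ha : 1 ≤ a)
    (htail : ∀ r : ℕ, μ {ω | ((r : ℝ) + 1) * t ≤ g ω} ≤
      ENNReal.ofReal (A * Real.exp (-(a * ((r : ℝ) + 1))))) :
    ∫ ω, {ω | t < g ω}.indicator (fun ω => g ω ^ 2) ω ∂μ ≤
      (∑' r : ℕ, 4 * ((r : ℝ) + 1) ^ 2 * Real.exp (-r)) * (t ^ 2 * A * Real.exp (-a)) := by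
  set F := {ω | t < g ω}.indicator fun ω => g ω ^ 2
  have hF0 : ∀ ω, 0 ≤ F ω := fun ω => Set.indicator_nonneg (fun _ _ => sq_nonneg _) ω
  have hFm : Measurable F := (hg.pow_const 2).indicator (measurableSet_lt measurable_const hg)
  have hC0 : 0 ≤ ∑' r : ℕ, 4 * ((r : ℝ) + 1) ^ 2 * Real.exp (-r) :=
    tsum_nonneg fun r => by positivity
  have hmeas : ∀ r : ℕ, MeasurableSet {ω | ((r : ℝ) + 1) * t ≤ g ω} := fun r =>
    measurableSet_le measurable_const hg
  have hpt : ∀ ω, ENNReal.ofReal (F ω) ≤ ∑' r : ℕ,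
      {ω | ((r : ℝ) + 1) * t ≤ g ω}.indicator
        (fun _ => ENNReal.ofReal (4 * ((r : ℝ) + 1) ^ 2 * t ^ 2)) ω := by
    intro ω
    by_cases hω : t < g ω
    · have h1 : 1 ≤ g ω / t := (one_le_div ht).2 hω.le
      have h1' : 1 ≤ ⌊g ω / t⌋₊ := Nat.le_floor (by simpa using h1)
      -- On the shell `(r+1) t ≤ g < (r+2) t` one has `g ≤ 2 (r+1) t`, so a single term of the
      -- series already dominates `g ^ 2`.
      obtain ⟨r, hr⟩ : ∃ r, ⌊g ω / t⌋₊ = r + 1 := ⟨_, (Nat.sub_add_cancel h1').symm⟩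
      have h2 : ((r : ℝ) + 1) * t ≤ g ω := by
        have := Nat.floor_le (zero_le_one.trans h1)
        rw [hr, le_div_iff₀ ht] at this
        push_cast at this
        exact this
      have h3 : g ω ≤ 2 * ((r : ℝ) + 1) * t := by
        have := Nat.lt_floor_add_one (g ω / t)
        rw [hr, div_lt_iff₀ ht] at this
        push_cast at this
        nlinarith [mul_nonneg (Nat.cast_nonneg (α := ℝ) r) ht.le]
      refine le_trans ?_ (ENNReal.le_tsum r)
      have hmem : ω ∈ {ω | ((r : ℝ) + 1) * t ≤ g ω} := h2
      rw [Set.indicator_of_mem hmem]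
      refine ENNReal.ofReal_le_ofReal ?_
      have hFω : F ω = g ω ^ 2 := Set.indicator_of_mem (s := {ω | t < g ω}) hω _
      rw [hFω]
      calc g ω ^ 2 ≤ (2 * ((r : ℝ) + 1) * t) ^ 2 := pow_le_pow_left₀ (ht.trans hω).le h3 2
        _ = _ := by ring
    · have hFω : F ω = 0 := Set.indicator_of_notMem (s := {ω | t < g ω}) hω _
      simp [hFω]
  have hlint : ∫⁻ ω, ENNReal.ofReal (F ω) ∂μ ≤ ENNReal.ofReal
      ((∑' r : ℕ, 4 * ((r : ℝ) + 1) ^ 2 * Real.exp (-r)) * (t ^ 2 * A * Real.exp (-a))) := by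
    calc _ ≤ ∫⁻ ω, ∑' r : ℕ, {ω | ((r : ℝ) + 1) * t ≤ g ω}.indicator
            (fun _ => ENNReal.ofReal (4 * ((r : ℝ) + 1) ^ 2 * t ^ 2)) ω ∂μ := lintegral_mono hpt
      _ = ∑' r : ℕ, ENNReal.ofReal (4 * ((r : ℝ) + 1) ^ 2 * t ^ 2) *
            μ {ω | ((r : ℝ) + 1) * t ≤ g ω} := by
          rw [lintegral_tsum fun r => (measurable_const.indicator (hmeas r)).aemeasurable]
          exact tsum_congr fun r => lintegral_indicator_const (hmeas r) _
      _ ≤ ∑' r : ℕ, ENNReal.ofReal (4 * ((r : ℝ) + 1) ^ 2 * Real.exp (-r) *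
            (t ^ 2 * A * Real.exp (-a))) := by
          refine ENNReal.tsum_le_tsum fun r => ?_
          refine (mul_le_mul_right (htail r) _).trans ?_
          rw [← ENNReal.ofReal_mul (by positivity)]
          refine ENNReal.ofReal_le_ofReal ?_
          have : Real.exp (-(a * ((r : ℝ) + 1))) ≤ Real.exp (-r) * Real.exp (-a) := by
            rw [← Real.exp_add]
            exact Real.exp_le_exp.2 (by nlinarith [Nat.cast_nonneg (α := ℝ) r])
          calc 4 * ((r : ℝ) + 1) ^ 2 * t ^ 2 * (A * Real.exp (-(a * ((r : ℝ) + 1))))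
              ≤ 4 * ((r : ℝ) + 1) ^ 2 * t ^ 2 * (A * (Real.exp (-r) * Real.exp (-a))) := by gcongr
            _ = _ := by ring
      _ = _ := by
          rw [← ENNReal.ofReal_tsum_of_nonneg (fun r => by positivity)
            (summable_succ_sq_mul_exp_neg.mul_right _), tsum_mul_right]
  have hnn : 0 ≤ (∑' r : ℕ, 4 * ((r : ℝ) + 1) ^ 2 * Real.exp (-r)) *
      (t ^ 2 * A * Real.exp (-a)) := by positivity
  rw [integral_eq_lintegral_of_nonneg_ae (.of_forall hF0) hFm.aestronglyMeasurable]
  exact ENNReal.toReal_le_of_le_ofReal hnn hlint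

end ExponentialMaximal

/-! ### Truncation and moments of the two parts. -/

section Truncation

/-- The restriction of the identity to `|y| ≤ τ`. -/
noncomputable def lowPart (τ y : ℝ) : ℝ := if |y| ≤ τ then y else 0

/-- The restriction of the absolute value to `|y| > τ`. -/
noncomputable def highPart (τ y : ℝ) : ℝ := if |y| ≤ τ then 0 else |y|

/-- The truncation at `τ`, centred with respect to `ν`. -/
noncomputable def lightPart (ν : Measure ℝ) (τ y : ℝ) : ℝ := lowPart τ y - ∫ z, lowPart τ z ∂ν

/-- A majorant of what remains after subtraction of `lightPart`. -/
noncomputable def heavyPart (ν : Measure ℝ) (τ y : ℝ) : ℝ := highPart τ y + |∫ z, lowPart τ z ∂ν|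

theorem measurable_lowPart (τ : ℝ) : Measurable (lowPart τ) :=
  Measurable.ite (measurableSet_le measurable_norm measurable_const) measurable_id measurable_const

theorem measurable_highPart (τ : ℝ) : Measurable (highPart τ) :=
  Measurable.ite (measurableSet_le measurable_norm measurable_const) measurable_const measurable_norm

theorem measurable_lightPart (ν : Measure ℝ) (τ : ℝ) : Measurable (lightPart ν τ) :=
  (measurable_lowPart τ).sub_const _

theorem measurable_heavyPart (ν : Measure ℝ) (τ : ℝ) : Measurable (heavyPart ν τ) :=
  (measurable_highPart τ).add_const _

theorem abs_lowPart_le {τ : ℝ} (hτ : 0 ≤ τ) (y : ℝ) : |lowPart τ y| ≤ τ := by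
  unfold lowPart
  split_ifs with h
  · exact h
  · simpa using hτ

theorem abs_lowPart_le_abs (τ y : ℝ) : |lowPart τ y| ≤ |y| := by
  unfold lowPart
  split_ifs <;> simp

theorem highPart_nonneg (τ y : ℝ) : 0 ≤ highPart τ y := by
  unfold highPart
  split_ifs <;> positivity

theorem heavyPart_nonneg (ν : Measure ℝ) (τ y : ℝ) : 0 ≤ heavyPart ν τ y :=
  add_nonneg (highPart_nonneg τ y) (abs_nonneg _)

theorem highPart_le_abs (τ y : ℝ) : highPart τ y ≤ |y| := by
  unfold highPart
  split_ifs <;> simp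

theorem abs_sub_lowPart (τ y : ℝ) : |y - lowPart τ y| = highPart τ y := by
  unfold lowPart highPart
  split_ifs <;> simp

theorem abs_sub_lightPart_le (ν : Measure ℝ) (τ y : ℝ) :
    |y - lightPart ν τ y| ≤ heavyPart ν τ y := by
  have h : y - lightPart ν τ y = (y - lowPart τ y) + ∫ z, lowPart τ z ∂ν := by
    unfold lightPart
    ring
  rw [h, heavyPart, ← abs_sub_lowPart]
  exact abs_add_le _ _

theorem highPart_mul_rpow_le {τ p : ℝ} (hτ : 0 < τ) (hp : 1 ≤ p) (y : ℝ) :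
    highPart τ y * τ ^ p ≤ τ * |y| ^ p := by
  unfold highPart
  split_ifs with h
  · rw [zero_mul]
    positivity
  · have hy : 0 < |y| := hτ.trans (not_le.1 h)
    have h1 : τ ^ (p - 1) ≤ |y| ^ (p - 1) :=
      Real.rpow_le_rpow hτ.le (not_le.1 h).le (by linarith)
    rw [Real.rpow_sub_one hτ.ne', Real.rpow_sub_one hy.ne', div_le_div_iff₀ hτ hy] at h1
    linarith

theorem highPart_sq_mul_rpow_le {τ p : ℝ} (hτ : 0 < τ) (hp : 2 ≤ p) (y : ℝ) :
    highPart τ y ^ 2 * τ ^ p ≤ τ ^ 2 * |y| ^ p := by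
  unfold highPart
  split_ifs with h
  · rw [zero_pow two_ne_zero, zero_mul]
    positivity
  · have hy : 0 < |y| := hτ.trans (not_le.1 h)
    have h1 : τ ^ (p - 2) ≤ |y| ^ (p - 2) :=
      Real.rpow_le_rpow hτ.le (not_le.1 h).le (by linarith)
    rw [Real.rpow_sub hτ, Real.rpow_sub hy, Real.rpow_two, Real.rpow_two,
      div_le_div_iff₀ (by positivity) (by positivity)] at h1
    linarith

variable {ν : Measure ℝ}

theorem memLp_highPart (τ : ℝ) (h2 : MemLp (fun y => y) 2 ν) : MemLp (highPart τ) 2 ν :=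
  h2.mono (measurable_highPart τ).aestronglyMeasurable (.of_forall fun y => by
    rw [Real.norm_eq_abs, Real.norm_eq_abs, abs_of_nonneg (highPart_nonneg τ y)]
    exact highPart_le_abs τ y)

theorem integral_highPart_le {τ p : ℝ} (hτ : 0 < τ) (hp : 1 ≤ p)
    (hint : Integrable (fun y => |y| ^ p) ν) :
    ∫ y, highPart τ y ∂ν ≤ τ / τ ^ p * ∫ y, |y| ^ p ∂ν := by
  rw [← integral_const_mul]
  refine integral_mono_of_nonneg (.of_forall fun y => highPart_nonneg τ y) (hint.const_mul _)
    (.of_forall fun y => ?_)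
  beta_reduce
  rw [div_mul_eq_mul_div, le_div_iff₀ (by positivity)]
  exact highPart_mul_rpow_le hτ hp y

theorem integral_highPart_sq_le {τ p : ℝ} (hτ : 0 < τ) (hp : 2 ≤ p)
    (hint : Integrable (fun y => |y| ^ p) ν) :
    ∫ y, highPart τ y ^ 2 ∂ν ≤ τ ^ 2 / τ ^ p * ∫ y, |y| ^ p ∂ν := by
  rw [← integral_const_mul]
  refine integral_mono_of_nonneg (.of_forall fun y => sq_nonneg _) (hint.const_mul _)
    (.of_forall fun y => ?_)
  beta_reduce
  rw [div_mul_eq_mul_div, le_div_iff₀ (by positivity)]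
  exact highPart_sq_mul_rpow_le hτ hp y

variable [IsProbabilityMeasure ν]

theorem abs_lightPart_le {τ : ℝ} (hτ : 0 ≤ τ) (y : ℝ) : |lightPart ν τ y| ≤ 2 * τ := by
  have h1 : |∫ z, lowPart τ z ∂ν| ≤ τ := by
    simpa using norm_integral_le_of_norm_le_const (μ := ν) (f := lowPart τ)
      (.of_forall fun y => abs_lowPart_le hτ y)
  have h2 := abs_sub (lowPart τ y) (∫ z, lowPart τ z ∂ν)
  have h3 := abs_lowPart_le hτ y
  unfold lightPart
  linarith

theorem integrable_lowPart {τ : ℝ} (hτ : 0 ≤ τ) : Integrable (lowPart τ) ν :=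
  integrable_of_measurable_of_abs_le (measurable_lowPart τ) (abs_lowPart_le hτ)

theorem integral_lightPart {τ : ℝ} (hτ : 0 ≤ τ) : ∫ y, lightPart ν τ y ∂ν = 0 := by
  unfold lightPart
  rw [integral_sub (integrable_lowPart hτ) (integrable_const _)]
  simp

/-- The left side is a variance, hence at most the uncentred second moment of the truncation. -/
theorem integral_lightPart_sq_le (τ : ℝ) (h2 : Integrable (fun y => y ^ 2) ν) :
    ∫ y, lightPart ν τ y ^ 2 ∂ν ≤ ∫ y, y ^ 2 ∂ν := by
  have hv : variance (lowPart τ) ν = ∫ y, lightPart ν τ y ^ 2 ∂ν :=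
    variance_eq_integral (measurable_lowPart τ).aemeasurable
  rw [← hv]
  refine (variance_le_expectation_sq (measurable_lowPart τ).aestronglyMeasurable).trans ?_
  refine integral_mono_of_nonneg (.of_forall fun y => sq_nonneg _) h2 (.of_forall fun y => ?_)
  exact sq_le_sq.2 (abs_lowPart_le_abs τ y)

/-- As `ν` is centred, the bias created by truncating is minus the mean of what was cut off. -/
theorem abs_integral_lowPart_le {τ : ℝ} (hτ : 0 ≤ τ) (h1 : Integrable (fun y => y) ν)
    (h0 : ∫ y, y ∂ν = 0) : |∫ y, lowPart τ y ∂ν| ≤ ∫ y, highPart τ y ∂ν := by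
  have h : ∫ y, lowPart τ y ∂ν = -∫ y, (y - lowPart τ y) ∂ν := by
    rw [integral_sub h1 (integrable_lowPart hτ), h0]
    ring
  rw [h, abs_neg]
  refine (abs_integral_le_integral_abs).trans_eq ?_
  simp_rw [abs_sub_lowPart]

end Truncation

/-! ### Expectations of the block functionals. -/

section Blocks

variable {ν : Measure ℝ} [IsProbabilityMeasure ν]

theorem integral_comp_eval {g : ℝ → ℝ} (hg : Measurable g) (i : ℕ) :
    ∫ x, g (x i) ∂Measure.infinitePi (fun _ : ℕ => ν) = ∫ y, g y ∂ν := by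
  conv_rhs => rw [← Measure.infinitePi_map_eval (fun _ : ℕ => ν) i]
  exact (integral_map (measurable_pi_apply i).aemeasurable hg.aestronglyMeasurable).symm

theorem memLp_comp_eval {g : ℝ → ℝ} (hg : MemLp g 2 ν) (i : ℕ) :
    MemLp (fun x : ℕ → ℝ => g (x i)) 2 (Measure.infinitePi fun _ : ℕ => ν) :=
  hg.comp_measurePreserving (measurePreserving_eval_infinitePi (fun _ : ℕ => ν) i)

theorem variance_comp_eval {g : ℝ → ℝ} (hg : Measurable g) (i : ℕ) :
    variance (fun x : ℕ → ℝ => g (x i)) (Measure.infinitePi fun _ : ℕ => ν) = variance g ν := by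
  rw [variance_eq_integral (Measurable.aemeasurable (by fun_prop)),
    variance_eq_integral hg.aemeasurable, integral_comp_eval hg]
  exact integral_comp_eval (g := fun y => (g y - ∫ z, g z ∂ν) ^ 2) (by fun_prop) i

/-- The second moment of a sum of independent copies of `g`. -/
theorem integral_sum_comp_eval_sq {g : ℝ → ℝ} (hgm : Measurable g) (hg : MemLp g 2 ν) (n : ℕ) :
    ∫ x, (∑ i ∈ Finset.range n, g (x i)) ^ 2 ∂Measure.infinitePi (fun _ : ℕ => ν) =
      n * variance g ν + (n * ∫ y, g y ∂ν) ^ 2 := by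
  set P := Measure.infinitePi fun _ : ℕ => ν
  set G : ℕ → (ℕ → ℝ) → ℝ := fun i x => g (x i)
  have hL : ∀ i ∈ Finset.range n, MemLp (G i) 2 P := fun i _ => memLp_comp_eval hg i
  have hind : iIndepFun G P := iIndepFun_infinitePi fun _ => hgm
  have hsum : MemLp (∑ i ∈ Finset.range n, G i) 2 P := memLp_finsetSum' _ hL
  have hv := IndepFun.variance_sum hL fun i _ j _ hij => hind.indepFun hij
  rw [variance_eq_sub hsum] at hv
  have hV : ∀ i, variance (G i) P = variance g ν := fun i => variance_comp_eval hgm i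
  have hm : ∫ x, ∑ i ∈ Finset.range n, G i x ∂P = n * ∫ y, g y ∂ν := by
    rw [integral_finsetSum _ fun i hi => (hL i hi).integrable one_le_two]
    simp [G, P, integral_comp_eval hgm]
  simp only [hV, Finset.sum_const, Finset.card_range, nsmul_eq_mul, Pi.pow_apply,
    Finset.sum_apply] at hv
  rw [hm] at hv
  linarith

/-- The total of the heavy parts of the first `n` terms. -/
noncomputable def heavySum (ν : Measure ℝ) (τ : ℝ) (n : ℕ) (x : ℕ → ℝ) : ℝ :=
  ∑ i ∈ Finset.range n, heavyPart ν τ (x i)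

/-- The square of the largest partial sum of the light parts of the first `n` terms, where this
partial sum exceeds `t`. -/
noncomputable def lightExcess (ν : Measure ℝ) (τ t : ℝ) (n : ℕ) : (ℕ → ℝ) → ℝ :=
  {x | t < partialSumMax n fun i => lightPart ν τ (x i)}.indicator
    fun x => (partialSumMax n fun i => lightPart ν τ (x i)) ^ 2

theorem measurable_heavySum (ν : Measure ℝ) (τ : ℝ) (n : ℕ) : Measurable (heavySum ν τ n) :=
  Finset.measurable_fun_sum _ fun i _ => (measurable_heavyPart ν τ).comp (measurable_pi_apply i)

theorem measurable_partialSumMax_lightPart (ν : Measure ℝ) (τ : ℝ) (n : ℕ) :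
    Measurable fun x : ℕ → ℝ => partialSumMax n fun i => lightPart ν τ (x i) :=
  (measurable_partialSumMax n).comp
    (measurable_pi_iff.2 fun i => (measurable_lightPart ν τ).comp (measurable_pi_apply i))

theorem measurable_lightExcess (ν : Measure ℝ) (τ t : ℝ) (n : ℕ) :
    Measurable (lightExcess ν τ t n) :=
  ((measurable_partialSumMax_lightPart ν τ n).pow_const 2).indicator
    (measurableSet_lt measurable_const (measurable_partialSumMax_lightPart ν τ n))

theorem lightExcess_nonneg (ν : Measure ℝ) (τ t : ℝ) (n : ℕ) (x : ℕ → ℝ) :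
    0 ≤ lightExcess ν τ t n x :=
  Set.indicator_nonneg (fun _ _ => sq_nonneg _) x

theorem memLp_heavyPart (τ : ℝ) (h2 : MemLp (fun y => y) 2 ν) : MemLp (heavyPart ν τ) 2 ν :=
  (memLp_highPart τ h2).add (memLp_const _)

theorem integrable_heavySum_sq (τ : ℝ) (n : ℕ) (h2 : MemLp (fun y => y) 2 ν) :
    Integrable (fun x => heavySum ν τ n x ^ 2) (Measure.infinitePi fun _ : ℕ => ν) :=
  (memLp_finsetSum _ fun i _ => memLp_comp_eval (memLp_heavyPart τ h2) i).integrable_sq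

/-- Variance plus squared mean. The factor 2 in the mean accounts for the centring constant, itself
bounded by the mean of `highPart`. -/
theorem integral_heavySum_sq_le {τ p : ℝ} (hτ : 0 < τ) (hp : 2 ≤ p)
    (h2 : MemLp (fun y => y) 2 ν) (h0 : ∫ y, y ∂ν = 0) (hint : Integrable (fun y => |y| ^ p) ν)
    (n : ℕ) :
    ∫ x, heavySum ν τ n x ^ 2 ∂Measure.infinitePi (fun _ : ℕ => ν) ≤
      n * (τ ^ 2 / τ ^ p * ∫ y, |y| ^ p ∂ν) + (n * (2 * (τ / τ ^ p * ∫ y, |y| ^ p ∂ν))) ^ 2 := by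
  have hv : variance (heavyPart ν τ) ν ≤ τ ^ 2 / τ ^ p * ∫ y, |y| ^ p ∂ν := by
    have h : variance (heavyPart ν τ) ν = variance (highPart τ) ν :=
      variance_add_const (measurable_highPart τ).aestronglyMeasurable _
    rw [h]
    exact (variance_le_expectation_sq (measurable_highPart τ).aestronglyMeasurable).trans
      (integral_highPart_sq_le hτ hp hint)
  have hm : ∫ y, heavyPart ν τ y ∂ν ≤ 2 * (τ / τ ^ p * ∫ y, |y| ^ p ∂ν) := by
    have h : ∫ y, heavyPart ν τ y ∂ν = ∫ y, highPart τ y ∂ν + |∫ z, lowPart τ z ∂ν| := by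
      unfold heavyPart
      rw [integral_add ((memLp_highPart τ h2).integrable one_le_two) (integrable_const _)]
      simp
    have h' := abs_integral_lowPart_le hτ.le (h2.integrable one_le_two) h0
    have h'' := integral_highPart_le hτ (by linarith) hint
    linarith
  have hm0 : 0 ≤ ∫ y, heavyPart ν τ y ∂ν := integral_nonneg (heavyPart_nonneg ν τ)
  unfold heavySum
  rw [integral_sum_comp_eval_sq (measurable_heavyPart ν τ) (memLp_heavyPart τ h2)]
  gcongr

theorem integrable_lightExcess {τ : ℝ} (hτ : 0 ≤ τ) (t : ℝ) (n : ℕ) :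
    Integrable (lightExcess ν τ t n) (Measure.infinitePi fun _ : ℕ => ν) := by
  refine integrable_of_measurable_of_abs_le (measurable_lightExcess ν τ t n)
    (K := (n * (2 * τ)) ^ 2) fun x => ?_
  rw [abs_of_nonneg (lightExcess_nonneg ν τ t n x)]
  refine (Set.indicator_le_self' (fun _ _ => sq_nonneg _) x).trans ?_
  exact pow_le_pow_left₀ (partialSumMax_nonneg _ _) (partialSumMax_le fun i => abs_lightPart_le hτ _) 2

/-- The choice `l = t / (2n)` minimises `n l^2 - l t`, with value `-t^2/(4n)`. `htτ` makes `l`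
admissible for steps bounded by `2τ`, and `htn` provides the rate `l t ≥ 1` needed to sum over
shells. -/
theorem integral_lightExcess_le {τ t : ℝ} {n : ℕ} (hτ : 0 ≤ τ) (ht : 0 < t) (hn : 0 < n)
    (h2 : Integrable (fun y => y ^ 2) ν) (h21 : ∫ y, y ^ 2 ∂ν ≤ 1)
    (htn : 2 * n ≤ t ^ 2) (htτ : t * τ ≤ n) :
    ∫ x, lightExcess ν τ t n x ∂Measure.infinitePi (fun _ : ℕ => ν) ≤
      (∑' r : ℕ, 4 * ((r : ℝ) + 1) ^ 2 * Real.exp (-r)) *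
        (2 * t ^ 2 * Real.exp (-(t ^ 2 / (4 * n)))) := by
  have hn' : (0 : ℝ) < n := by exact_mod_cast hn
  have hl : t / (2 * n) * (2 * τ) ≤ 1 := by
    rw [div_mul_eq_mul_div, div_le_one (by positivity)]
    linarith
  have htail := integral_indicator_sq_le_of_exp_tail
    (μ := Measure.infinitePi fun _ : ℕ => ν) (measurable_partialSumMax_lightPart ν τ n) ht
    (A := 2 * Real.exp (n * (t / (2 * n)) ^ 2)) (a := t / (2 * n) * t) (by positivity)
    (by rw [div_mul_eq_mul_div, one_le_div (by positivity)]; linarith) (fun r => by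
      have h := measure_le_partialSumMax_le (μ := Measure.infinitePi fun _ : ℕ => ν)
        (Y := fun i x => lightPart ν τ (x i)) (K := 2 * τ) (l := t / (2 * n))
        (u := ((r : ℝ) + 1) * t)
        (fun i => (measurable_lightPart ν τ).comp (measurable_pi_apply i))
        (iIndepFun_infinitePi fun _ => measurable_lightPart ν τ)
        (fun i x => abs_lightPart_le hτ _)
        (fun i => by rw [integral_comp_eval (measurable_lightPart ν τ), integral_lightPart hτ])
        (fun i => by
          rw [integral_comp_eval (g := fun y => lightPart ν τ y ^ 2)
            ((measurable_lightPart ν τ).pow_const 2)]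
          exact (integral_lightPart_sq_le τ h2).trans h21)
        (by positivity) hl (by positivity) n
      rwa [show t / (2 * n) * (((r : ℝ) + 1) * t) = t / (2 * n) * t * ((r : ℝ) + 1) by ring] at h)
  refine htail.trans_eq ?_
  have he : Real.exp (-(t ^ 2 / (4 * n))) =
      Real.exp (n * (t / (2 * n)) ^ 2) * Real.exp (-(t / (2 * n) * t)) := by
    rw [← Real.exp_add]
    congr 1
    field_simp
    ring
  rw [he]
  ring

end Blocks

/-! ### From intervals of a partition to dyadic blocks. -/

section Partitions

theorem abs_sum_Ico_le_two_mul_partialSumMax {a b c n : ℕ} (hca : c ≤ a) (hab : a ≤ b)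
    (hbn : b ≤ c + n) (z : ℕ → ℝ) :
    |∑ i ∈ Finset.Ico a b, z i| ≤ 2 * partialSumMax n fun i => z (i + c) := by
  have h : ∑ i ∈ Finset.Ico a b, z i = ∑ i ∈ Finset.range (b - c), z (i + c) -
      ∑ i ∈ Finset.range (a - c), z (i + c) := by
    rw [← Finset.sum_Ico_eq_sub _ (Nat.sub_le_sub_right hab c),
      Finset.sum_Ico_add' z (a - c) (b - c) c, Nat.sub_add_cancel hca,
      Nat.sub_add_cancel (hca.trans hab)]
  have h1 := abs_sum_le_partialSumMax (m := b - c) (n := n) (by lia) fun i => z (i + c)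
  have h2 := abs_sum_le_partialSumMax (m := a - c) (n := n) (by lia) fun i => z (i + c)
  rw [h]
  exact (abs_sub _ _).trans (by linarith)

theorem sum_Ico_le_sum_range {a b c n : ℕ} (hca : c ≤ a) (hbn : b ≤ c + n) {z : ℕ → ℝ}
    (hz : ∀ i, 0 ≤ z i) :
    ∑ i ∈ Finset.Ico a b, z i ≤ ∑ i ∈ Finset.range n, z (i + c) := by
  rw [Finset.range_eq_Ico, Finset.sum_Ico_add' z 0 n c]
  exact Finset.sum_le_sum_of_subset_of_nonneg (Finset.Ico_subset_Ico (by lia) (by lia))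
    fun i _ _ => hz i

/-- A large interval sum is controlled by the block functionals of any block containing the
interval. -/
theorem intervalSum_sq_le {ν : Measure ℝ} {τ t : ℝ} {a b c n : ℕ} (hca : c ≤ a) (hab : a ≤ b)
    (hbn : b ≤ c + n) (x : ℕ → ℝ)
    (h : 16 * t ^ 2 < intervalSum x (Finset.Ico a b) ^ 2) :
    intervalSum x (Finset.Ico a b) ^ 2 ≤ 16 * (lightExcess ν τ t n (fun i => x (i + c)) +
      heavySum ν τ n (fun i => x (i + c)) ^ 2) := by
  set S := intervalSum x (Finset.Ico a b)
  set M := partialSumMax n fun i => lightPart ν τ (x (i + c)) with hMdef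
  set V := heavySum ν τ n fun i => x (i + c)
  have hM : |∑ i ∈ Finset.Ico a b, lightPart ν τ (x i)| ≤ 2 * M :=
    abs_sum_Ico_le_two_mul_partialSumMax hca hab hbn fun i => lightPart ν τ (x i)
  have hV : |∑ i ∈ Finset.Ico a b, (x i - lightPart ν τ (x i))| ≤ V :=
    (Finset.abs_sum_le_sum_abs _ _).trans <|
      (Finset.sum_le_sum fun i _ => abs_sub_lightPart_le ν τ (x i)).trans
        (sum_Ico_le_sum_range hca hbn (z := fun i => heavyPart ν τ (x i))
          fun i => heavyPart_nonneg ν τ (x i))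
  have hS : |S| ≤ 2 * M + V := by
    have : S = ∑ i ∈ Finset.Ico a b, lightPart ν τ (x i) +
        ∑ i ∈ Finset.Ico a b, (x i - lightPart ν τ (x i)) := by
      rw [← Finset.sum_add_distrib]
      exact Finset.sum_congr rfl fun i _ => by ring
    rw [this]
    exact (abs_add_le _ _).trans (add_le_add hM hV)
  have hM0 : 0 ≤ M := partialSumMax_nonneg _ _
  have hV0 : 0 ≤ V := (abs_nonneg _).trans hV
  have hE0 := lightExcess_nonneg ν τ t n fun i => x (i + c)
  rw [← sq_abs S] at h ⊢
  rcases le_total |S| (2 * V) with hSV | hSV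
  -- If `V` dominates, `S^2 ≤ 4 V^2`. Otherwise `|S| ≤ 4 M`, and `16 t^2 < S^2` forces `M > t`, so
  -- the indicator in `lightExcess` equals 1.
  · nlinarith [abs_nonneg S]
  · have hSM : |S| ≤ 4 * M := by linarith
    have htM : t < M := by
      have h4 : (4 * t) ^ 2 < |S| ^ 2 := by linarith
      have := lt_of_pow_lt_pow_left₀ 2 (abs_nonneg S) h4
      linarith
    have hE : lightExcess ν τ t n (fun i => x (i + c)) = M ^ 2 := by
      rw [lightExcess, Set.indicator_of_mem]
      exact htM
    rw [hE]
    nlinarith [abs_nonneg S, sq_nonneg V]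

/-- Disjoint intervals are determined by their dyadic level `k` and by the dyadic block of length
`2 ^ k` in which they start. -/
theorem sum_parts_le_sum_blocks {N : ℕ} (π : IntervalPartition N) {s : Finset (Finset ℕ)}
    (hs : s ⊆ π.1.parts) {f : Finset ℕ → ℝ} {G : ℕ → ℕ → ℝ} (hG : ∀ k q, 0 ≤ G k q)
    (h : ∀ a b, Finset.Ico a b ∈ s → a < b → b ≤ N →
      f (Finset.Ico a b) ≤ G (Nat.log 2 (b - a)) (a / 2 ^ Nat.log 2 (b - a))) :
    ∑ I ∈ s, f I ≤ ∑ k ∈ Finset.range (Nat.log 2 N + 1),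
      ∑ q ∈ Finset.range (N / 2 ^ k + 1), G k q := by
  classical
  have hex : ∀ I ∈ s, ∃ a b : ℕ, I = Finset.Ico a b ∧ a < b ∧ b ≤ N := by
    intro I hI
    obtain ⟨a, b, hab⟩ := π.2 I (hs hI)
    have hne : a < b := by
      rw [← Finset.nonempty_Ico, ← hab]
      exact π.1.nonempty_of_mem_parts (hs hI)
    refine ⟨a, b, hab, hne, ?_⟩
    have hsub := π.1.le (hs hI)
    have hmem : b - 1 ∈ Finset.range N := hsub (by rw [hab, Finset.mem_Ico]; lia)
    have := Finset.mem_range.1 hmem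
    lia
  choose! a b hI hab hbN using hex
  set g : Finset ℕ → (_ : ℕ) × ℕ := fun I =>
    ⟨Nat.log 2 (b I - a I), a I / 2 ^ Nat.log 2 (b I - a I)⟩
  have hlen : ∀ I ∈ s, 2 ^ Nat.log 2 (b I - a I) ≤ b I - a I := fun I hIs =>
    Nat.pow_log_le_self 2 (Nat.sub_ne_zero_of_lt (hab I hIs))
  have hmap : ∀ I ∈ s, g I ∈ (Finset.range (Nat.log 2 N + 1)).sigma
      fun k => Finset.range (N / 2 ^ k + 1) := by
    intro I hIs
    have h1 := hab I hIs
    have h2 := hbN I hIs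
    simp only [g, Finset.mem_sigma, Finset.mem_range, Nat.lt_succ_iff]
    exact ⟨Nat.log_mono_right (by lia), Nat.div_le_div_right (by lia)⟩
  -- Starting points in the same block of length `2^k` differ by less than `2^k ≤ |I|`, so the later
  -- one lies in both intervals.
  have hcore : ∀ I ∈ s, ∀ J ∈ s, g I = g J → a I ≤ a J → I = J := by
    intro I hIs J hJs hg hle
    by_contra hne
    have hdisj : Disjoint I J := π.1.disjoint (hs hIs) (hs hJs) hne
    obtain ⟨hk, hq⟩ := Sigma.mk.inj_iff.1 hg
    have hq := eq_of_heq hq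
    rw [← hk] at hq
    have hpos : 0 < 2 ^ Nat.log 2 (b I - a I) := by positivity
    have h1 := Nat.div_mul_le_self (a I) (2 ^ Nat.log 2 (b I - a I))
    have h2 := Nat.lt_div_mul_add (a := a J) hpos
    rw [← hq] at h2
    have h3 := hlen I hIs
    have h4 := hab I hIs
    have h5 := hab J hJs
    have hmI : a J ∈ I := by
      rw [hI I hIs, Finset.mem_Ico]
      lia
    have hmJ : a J ∈ J := by
      have := Finset.left_mem_Ico.2 h5
      rwa [← hI J hJs] at this
    exact Finset.disjoint_left.1 hdisj hmI hmJ
  have hinj : Set.InjOn g s := by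
    intro I hIs J hJs hg
    rcases le_total (a I) (a J) with hle | hle
    · exact hcore I hIs J hJs hg hle
    · exact (hcore J hJs I hIs hg.symm hle).symm
  calc ∑ I ∈ s, f I ≤ ∑ I ∈ s, G (g I).1 (g I).2 := by
        refine Finset.sum_le_sum fun I hIs => ?_
        have := h (a I) (b I) (hI I hIs ▸ hIs) (hab I hIs) (hbN I hIs)
        rwa [← hI I hIs] at this
    _ = ∑ z ∈ s.image g, G z.1 z.2 := (Finset.sum_image (f := fun z => G z.1 z.2) hinj).symm
    _ ≤ ∑ z ∈ (Finset.range (Nat.log 2 N + 1)).sigma fun k => Finset.range (N / 2 ^ k + 1),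
          G z.1 z.2 :=
        Finset.sum_le_sum_of_subset_of_nonneg (Finset.image_subset_iff.2 hmap)
          fun z _ _ => hG _ _
    _ = _ := Finset.sum_sigma _ _ _

end Partitions

/-! ### Invariance of the product measure under shifts. -/

section Shift

/-- The shift of a sequence by `c` places. -/
def seqShift (c : ℕ) (x : ℕ → ℝ) : ℕ → ℝ := fun i => x (i + c)

theorem seqShift_iterate (c q : ℕ) (x : ℕ → ℝ) : (seqShift c)^[q] x = fun i => x (i + q * c) := by
  induction q generalizing x with
  | zero => simp
  | succ q ih =>
    rw [Function.iterate_succ_apply, ih]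
    ext i
    simp only [seqShift]
    congr 1
    ring

theorem measurePreserving_seqShift (ν : Measure ℝ) [IsProbabilityMeasure ν] (c : ℕ) :
    MeasurePreserving (seqShift c) (Measure.infinitePi fun _ : ℕ => ν)
      (Measure.infinitePi fun _ : ℕ => ν) := by
  have hind : iIndepFun (fun (i : ℕ) (x : ℕ → ℝ) => x i) (Measure.infinitePi fun _ : ℕ => ν) :=
    iIndepFun_infinitePi (X := fun _ y => y) fun _ => measurable_id
  have hshift := hind.precomp (g := fun i => i + c) (add_left_injective c)
  refine ⟨measurable_pi_iff.2 fun i => measurable_pi_apply (i + c), ?_⟩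
  have := hshift.map_fun_eq_infinitePi_map fun i => measurable_pi_apply (i + c)
  refine Eq.trans this ?_
  congr 1
  ext1 i
  exact Measure.infinitePi_map_eval (fun _ : ℕ => ν) (i + c)

end Shift

/-! ### Choice of parameters at scale `2^k` and summability. -/

section Levels

/-- The truncation level for intervals of length about `2 ^ k`. -/
noncomputable def levelTrunc (p : ℝ) (k : ℕ) : ℝ := ((2 : ℝ) ^ k) ^ p⁻¹

/-- The size at which the light part of an interval of length about `2 ^ k` is excessive. -/
noncomputable def levelThreshold (B : ℝ) (k : ℕ) : ℝ :=
  √(B * 2 ^ k * Real.log (Real.log (2 ^ k)) / 16)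

/-- The functional of a block of length `3 * 2 ^ k` that controls the squares of the large sums over
intervals of length about `2 ^ k` starting in its first third. -/
noncomputable def blockMajorant (ν : Measure ℝ) (p B : ℝ) (k : ℕ) (x : ℕ → ℝ) : ℝ :=
  lightExcess ν (levelTrunc p k) (levelThreshold B k) (3 * 2 ^ k) x +
    heavySum ν (levelTrunc p k) (3 * 2 ^ k) x ^ 2

theorem blockMajorant_nonneg (ν : Measure ℝ) (p B : ℝ) (k : ℕ) (x : ℕ → ℝ) :
    0 ≤ blockMajorant ν p B k x :=
  add_nonneg (lightExcess_nonneg _ _ _ _ _) (sq_nonneg _)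

theorem measurable_blockMajorant (ν : Measure ℝ) (p B : ℝ) (k : ℕ) :
    Measurable (blockMajorant ν p B k) :=
  (measurable_lightExcess _ _ _ _).add ((measurable_heavySum _ _ _).pow_const 2)

theorem levelTrunc_pos (p : ℝ) (k : ℕ) : 0 < levelTrunc p k := by
  unfold levelTrunc
  positivity

theorem levelTrunc_rpow {p : ℝ} (hp : p ≠ 0) (k : ℕ) : levelTrunc p k ^ p = 2 ^ k := by
  unfold levelTrunc
  rw [← Real.rpow_mul (by positivity), inv_mul_cancel₀ hp, Real.rpow_one]

/-- For `p > 2` the exponent `2/p - 1` is negative, so the squared truncation level is geometrically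
smaller than `2^k`. -/
theorem levelTrunc_sq (p : ℝ) (k : ℕ) :
    levelTrunc p k ^ 2 = 2 ^ k * ((2 : ℝ) ^ (2 * p⁻¹ - 1)) ^ k := by
  unfold levelTrunc
  rw [Real.rpow_pow_comm two_pos.le, Real.rpow_sub_one (by positivity), mul_comm 2,
    Real.rpow_mul (by positivity), Real.rpow_two]
  field_simp

variable {ν : Measure ℝ} [IsProbabilityMeasure ν]

theorem integrable_blockMajorant (h2 : MemLp (fun y => y) 2 ν) (p B : ℝ) (k : ℕ) :
    Integrable (blockMajorant ν p B k) (Measure.infinitePi fun _ : ℕ => ν) :=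
  (integrable_lightExcess (levelTrunc_pos p k).le _ _).add (integrable_heavySum_sq _ _ h2)

theorem integral_heavySum_level_le {p : ℝ} (hp : 2 ≤ p) (h2 : MemLp (fun y => y) 2 ν)
    (h0 : ∫ y, y ∂ν = 0) (hint : Integrable (fun y => |y| ^ p) ν) (k : ℕ) :
    ∫ x, heavySum ν (levelTrunc p k) (3 * 2 ^ k) x ^ 2 ∂Measure.infinitePi (fun _ : ℕ => ν) ≤
      (3 * (∫ y, |y| ^ p ∂ν) + 36 * (∫ y, |y| ^ p ∂ν) ^ 2) * levelTrunc p k ^ 2 := by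
  refine (integral_heavySum_sq_le (levelTrunc_pos p k) hp h2 h0 hint _).trans_eq ?_
  rw [levelTrunc_rpow (by linarith)]
  push_cast
  field_simp
  ring

/-- One sixth of the exponent absorbs the factor `y`. -/
theorem mul_exp_neg_le {y l : ℝ} (h : 6 * l ≤ y) : y * Real.exp (-y) ≤ 6 * Real.exp (-(5 * l)) := by
  have h1 : y / 6 ≤ Real.exp (y / 6) := by
    have := Real.add_one_le_exp (y / 6)
    linarith
  calc y * Real.exp (-y) = 6 * (y / 6 * Real.exp (-y)) := by ring
    _ ≤ 6 * (Real.exp (y / 6) * Real.exp (-y)) := by gcongr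
    _ = 6 * Real.exp (-(5 * (y / 6))) := by
        rw [← Real.exp_add]
        ring_nf
    _ ≤ 6 * Real.exp (-(5 * l)) := by
        gcongr
        linarith

/-- With `l = ln ln 2^k`, the exponent `t^2/(4n)` for `n = 3 * 2^k` is `B l / 192`, and `1152 = 6 *
192` makes it at least `6 l`. `hlτ` is the condition `t τ ≤ n`, squared. -/
theorem integral_lightExcess_level_le {p B : ℝ} {k : ℕ} (hB : 1152 ≤ B)
    (h2 : Integrable (fun y => y ^ 2) ν) (h21 : ∫ y, y ^ 2 ∂ν ≤ 1)
    (hl : 1 ≤ Real.log (Real.log (2 ^ k)))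
    (hlτ : B * Real.log (Real.log (2 ^ k)) * levelTrunc p k ^ 2 ≤ 144 * 2 ^ k) :
    ∫ x, lightExcess ν (levelTrunc p k) (levelThreshold B k) (3 * 2 ^ k) x
        ∂Measure.infinitePi (fun _ : ℕ => ν) ≤
      (∑' r : ℕ, 4 * ((r : ℝ) + 1) ^ 2 * Real.exp (-r)) *
        (144 * 2 ^ k * Real.exp (-(5 * Real.log (Real.log (2 ^ k))))) := by
  set l := Real.log (Real.log (2 ^ k))
  have hB0 : 0 < B := by linarith
  have hBl : 1152 ≤ B * l := by nlinarith
  have harg : 0 < B * 2 ^ k * l / 16 := by positivity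
  have ht2 : levelThreshold B k ^ 2 = B * 2 ^ k * l / 16 := Real.sq_sqrt harg.le
  have ht : 0 < levelThreshold B k := Real.sqrt_pos.2 harg
  have hQ : (0 : ℝ) < 2 ^ k := by positivity
  have hτ := levelTrunc_pos p k
  refine (integral_lightExcess_le hτ.le ht (by positivity) h2 h21 ?_ ?_).trans ?_
  · rw [ht2]
    push_cast
    nlinarith
  · push_cast
    refine le_of_sq_le_sq ?_ (by positivity)
    rw [mul_pow, ht2]
    nlinarith
  · rw [ht2]
    have hy : B * 2 ^ k * l / 16 / (4 * ((3 * 2 ^ k : ℕ) : ℝ)) = B * l / 192 := by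
      push_cast
      field_simp
      norm_num
    rw [hy]
    have h := mul_exp_neg_le (y := B * l / 192) (l := l) (by nlinarith)
    refine mul_le_mul_of_nonneg_left ?_ (tsum_nonneg fun r => by positivity)
    calc 2 * (B * 2 ^ k * l / 16) * Real.exp (-(B * l / 192))
        = 24 * 2 ^ k * (B * l / 192 * Real.exp (-(B * l / 192))) := by ring
      _ ≤ 24 * 2 ^ k * (6 * Real.exp (-(5 * l))) := by gcongr
      _ = _ := by ring

/-- The left side is `(k ln 2)^(-5)`; `ln 2 > 1/2` gives `32 = 2^5`. -/
theorem exp_neg_five_mul_log_log_le {k : ℕ} (hk : 1 ≤ k) :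
    Real.exp (-(5 * Real.log (Real.log (2 ^ k)))) ≤ 32 / (k : ℝ) ^ 5 := by
  have hk' : (0 : ℝ) < k := by exact_mod_cast hk
  have hlog : 0 < Real.log (2 ^ k) := by
    rw [Real.log_pow]
    exact mul_pos hk' (Real.log_pos one_lt_two)
  have h : (k : ℝ) / 2 ≤ Real.log (2 ^ k) := by
    rw [Real.log_pow]
    nlinarith [Real.log_two_gt_d9]
  rw [Real.exp_neg, show (5 : ℝ) = ((5 : ℕ) : ℝ) by norm_num, Real.exp_nat_mul,
    Real.exp_log hlog, inv_le_comm₀ (by positivity) (by positivity), inv_div]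
  calc (k : ℝ) ^ 5 / 32 = ((k : ℝ) / 2) ^ 5 := by ring
    _ ≤ _ := by gcongr

theorem summable_integral_blockMajorant {p B : ℝ} (hp : 2 < p) (hB : 1152 ≤ B)
    (h2 : MemLp (fun y => y) 2 ν) (h0 : ∫ y, y ∂ν = 0) (h21 : ∫ y, y ^ 2 ∂ν ≤ 1)
    (hint : Integrable (fun y => |y| ^ p) ν) :
    Summable fun k : ℕ =>
      (∫ x, blockMajorant ν p B k x ∂Measure.infinitePi (fun _ : ℕ => ν)) /
        (2 ^ k / ((k : ℝ) + 1) ^ 2) := by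
  set r : ℝ := (2 : ℝ) ^ (2 * p⁻¹ - 1)
  set D := 3 * (∫ y, |y| ^ p ∂ν) + 36 * (∫ y, |y| ^ p ∂ν) ^ 2
  set K := ∑' r : ℕ, 4 * ((r : ℝ) + 1) ^ 2 * Real.exp (-r)
  have hK : 0 ≤ K := tsum_nonneg fun r => by positivity
  have hr0 : 0 < r := Real.rpow_pos_of_pos two_pos _
  have hr1 : r < 1 := by
    refine Real.rpow_lt_one_of_one_lt_of_neg one_lt_two ?_
    have : p⁻¹ < 2⁻¹ := inv_strictAnti₀ two_pos hp
    linarith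
  have hD0 : 0 ≤ D := by
    have : 0 ≤ ∫ y, |y| ^ p ∂ν := integral_nonneg fun y => by positivity
    positivity
  have hgeom : Summable fun k : ℕ => D * (((k : ℝ) + 1) ^ 2 * r ^ k) := by
    refine Summable.mul_left D ?_
    have h := (summable_nat_add_iff 1).2 (summable_pow_mul_geometric_of_norm_lt_one 2
      (r := r) (by rwa [Real.norm_eq_abs, abs_of_pos hr0]))
    refine (h.mul_left r⁻¹).congr fun k => ?_
    push_cast
    rw [pow_succ r k]
    field_simp
  have hpoly : Summable fun k : ℕ => K * 144 * 128 * (1 / (k : ℝ) ^ 3) :=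
    (Real.summable_one_div_nat_pow.2 (by norm_num)).mul_left _
  have hloglog : Tendsto (fun k : ℕ => Real.log (Real.log (2 ^ k))) atTop atTop := by
    refine Real.tendsto_log_atTop.comp (Real.tendsto_log_atTop.comp ?_)
    exact tendsto_pow_atTop_atTop_of_one_lt one_lt_two
  have hsmall : ∀ᶠ k : ℕ in atTop, B * ((k : ℝ) * r ^ k) ≤ 144 := by
    have := (tendsto_self_mul_const_pow_of_lt_one hr0.le hr1).const_mul B
    rw [mul_zero] at this
    exact this.eventually_le_const (by norm_num)
  -- `hgeom` dominates the heavy parts and `hpoly` the light ones. Finitely many `k` are discarded,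
  -- where `ln ln 2^k < 1` or the truncation level is still too large.
  refine Summable.of_norm_bounded_eventually_nat (hgeom.add hpoly) ?_
  filter_upwards [hloglog.eventually_ge_atTop 1, hsmall, eventually_ge_atTop 1] with k hl hk hk1
  have hk' : (1 : ℝ) ≤ k := by exact_mod_cast hk1
  have hQ : (0 : ℝ) < 2 ^ k := by positivity
  have hlk : Real.log (Real.log (2 ^ k)) ≤ k := by
    have hlog0 : 0 < Real.log (2 ^ k) := by
      rw [Real.log_pow]
      exact mul_pos (by linarith) (Real.log_pos one_lt_two)
    refine (Real.log_le_self hlog0.le).trans ?_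
    rw [Real.log_pow]
    nlinarith [Real.log_two_lt_d9]
  have hlight := integral_lightExcess_level_le (p := p) hB h2.integrable_sq h21 hl (by
    rw [levelTrunc_sq]
    calc B * Real.log (Real.log (2 ^ k)) * (2 ^ k * r ^ k) ≤ B * k * (2 ^ k * r ^ k) := by gcongr
      _ = B * ((k : ℝ) * r ^ k) * 2 ^ k := by ring
      _ ≤ _ := by gcongr)
  have hheavy := integral_heavySum_level_le hp.le h2 h0 hint k
  have hsplit : ∫ x, blockMajorant ν p B k x ∂Measure.infinitePi (fun _ : ℕ => ν) =
      _ + _ := integral_add (integrable_lightExcess (levelTrunc_pos p k).le _ _)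
        (integrable_heavySum_sq _ _ h2)
  have hnn : 0 ≤ ∫ x, blockMajorant ν p B k x ∂Measure.infinitePi (fun _ : ℕ => ν) :=
    integral_nonneg fun x => blockMajorant_nonneg ν p B k x
  rw [Real.norm_eq_abs, abs_of_nonneg (by positivity), div_div_eq_mul_div,
    div_le_iff₀ hQ, hsplit]
  have hexp := exp_neg_five_mul_log_log_le hk1
  have hpoly' : ((k : ℝ) + 1) ^ 2 * (32 / (k : ℝ) ^ 5) ≤ 128 * (1 / (k : ℝ) ^ 3) := by
    have h4 : ((k : ℝ) + 1) ^ 2 ≤ 4 * (k : ℝ) ^ 2 := by nlinarith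
    calc ((k : ℝ) + 1) ^ 2 * (32 / (k : ℝ) ^ 5) ≤ 4 * (k : ℝ) ^ 2 * (32 / (k : ℝ) ^ 5) := by gcongr
      _ = _ := by
        field_simp
        norm_num
  rw [levelTrunc_sq] at hheavy
  calc _ ≤ (K * (144 * 2 ^ k * (32 / (k : ℝ) ^ 5)) + D * (2 ^ k * r ^ k)) * ((k : ℝ) + 1) ^ 2 := by
        gcongr
        exact hlight.trans (by gcongr)
    _ = (D * (((k : ℝ) + 1) ^ 2 * r ^ k) +
          K * 144 * (((k : ℝ) + 1) ^ 2 * (32 / (k : ℝ) ^ 5))) * 2 ^ k := by ring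
    _ ≤ (D * (((k : ℝ) + 1) ^ 2 * r ^ k) + K * 144 * (128 * (1 / (k : ℝ) ^ 3))) * 2 ^ k := by
        gcongr
    _ = _ := by ring

end Levels

/-! ### Linear bound for the bad contribution. -/

section BadIntervals

theorem log_log_two_pow_le {N k : ℕ} (hN : 3 ≤ N) (hk : 2 ^ k ≤ N) :
    Real.log (Real.log (2 ^ k)) ≤ Real.log (Real.log N) := by
  have hN' : (3 : ℝ) ≤ N := by exact_mod_cast hN
  -- At `k = 0` the left side is `Real.log 0 = 0`, so `ln ln N ≥ 0` is needed; it follows from `N ≥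
  -- 3 > e`.
  rcases Nat.eq_zero_or_pos k with rfl | hk0
  · have h1 : 1 ≤ Real.log N := by
      rw [Real.le_log_iff_exp_le (by linarith)]
      linarith [Real.exp_one_lt_d9]
    simpa using Real.log_nonneg h1
  · have hlog : 0 < Real.log (2 ^ k) := by
      rw [Real.log_pow]
      exact mul_pos (by exact_mod_cast hk0) (Real.log_pos one_lt_two)
    have hk' : (2 : ℝ) ^ k ≤ N := by exact_mod_cast hk
    gcongr

/-- The sum over a bad interval is controlled by the majorant of its block. -/
theorem intervalSum_sq_le_blockMajorant {ν : Measure ℝ} {p B : ℝ} (hB : 0 ≤ B) {N a b : ℕ}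
    (hN : 3 ≤ N) (hab : a < b) (hbN : b ≤ N) (x : ℕ → ℝ)
    (hbad : B * ((Finset.Ico a b).card : ℝ) * Real.log (Real.log N) <
      intervalSum x (Finset.Ico a b) ^ 2) :
    intervalSum x (Finset.Ico a b) ^ 2 ≤ 16 * blockMajorant ν p B (Nat.log 2 (b - a))
      ((seqShift (2 ^ Nat.log 2 (b - a)))^[a / 2 ^ Nat.log 2 (b - a)] x) := by
  set k := Nat.log 2 (b - a)
  have hk1 : 2 ^ k ≤ b - a := Nat.pow_log_le_self 2 (by lia)
  have hk2 : b - a < 2 ^ (k + 1) := Nat.lt_pow_succ_log_self one_lt_two _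
  have hq1 : a / 2 ^ k * 2 ^ k ≤ a := Nat.div_mul_le_self a (2 ^ k)
  have hq2 : a < a / 2 ^ k * 2 ^ k + 2 ^ k := Nat.lt_div_mul_add (by positivity)
  rcases eq_or_ne (intervalSum x (Finset.Ico a b)) 0 with hS | hS
  · rw [hS, zero_pow two_ne_zero]
    exact mul_nonneg (by norm_num) (blockMajorant_nonneg _ _ _ _ _)
  rw [seqShift_iterate]
  -- With `q = a / 2^k`: `a < (q+1) 2^k` and `b - a < 2 * 2^k` give `b ≤ (q+3) 2^k`, whence blocks
  -- of length `3 * 2^k`.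
  refine intervalSum_sq_le hq1 hab.le (by rw [pow_succ] at hk2; lia) x ?_
  -- At the smallest scales the radicand is nonpositive and the threshold is 0, which any nonzero
  -- sum exceeds.
  rcases le_or_gt (Real.log (Real.log (2 ^ k))) 0 with hl | hl
  · have : levelThreshold B k = 0 := Real.sqrt_eq_zero_of_nonpos (by
      have : B * 2 ^ k * Real.log (Real.log (2 ^ k)) ≤ 0 :=
        mul_nonpos_of_nonneg_of_nonpos (by positivity) hl
      linarith)
    rw [this]
    simpa using pow_pos (abs_pos.2 hS) 2
  · refine lt_of_le_of_lt ?_ hbad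
    have hlN := log_log_two_pow_le hN (hk1.trans (by lia))
    have hcard : (2 : ℝ) ^ k ≤ ((Finset.Ico a b).card : ℝ) := by
      rw [Nat.card_Ico]
      exact_mod_cast hk1
    rw [levelThreshold, Real.sq_sqrt (by positivity), mul_div_cancel₀ _ (by norm_num)]
    gcongr

theorem summable_one_div_succ_sq : Summable fun k : ℕ => 1 / ((k : ℝ) + 1) ^ 2 := by
  have h := (summable_nat_add_iff 1).2 (Real.summable_one_div_nat_pow (p := 2) |>.2 one_lt_two)
  exact_mod_cast h

/-- Bounds for the Birkhoff sums of the block majorants yield a linear bound for the contribution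
of the bad intervals. -/
theorem badContribution_le {ν : Measure ℝ} {p B C : ℝ} (hB : 0 ≤ B) (hC : 0 ≤ C) {x : ℕ → ℝ}
    (hx : ∀ k n : ℕ, birkhoffSum (seqShift (2 ^ k)) (blockMajorant ν p B k) n x ≤
      C * (2 ^ k / ((k : ℝ) + 1) ^ 2) * n) {N : ℕ} (hN : 3 ≤ N) (π : IntervalPartition N) :
    badContribution B x π ≤ 32 * C * (∑' k : ℕ, 1 / ((k : ℝ) + 1) ^ 2) * N := by
  classical
  unfold badContribution
  calc _ ≤ ∑ k ∈ Finset.range (Nat.log 2 N + 1), ∑ q ∈ Finset.range (N / 2 ^ k + 1),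
          16 * blockMajorant ν p B k ((seqShift (2 ^ k))^[q] x) := by
        refine sum_parts_le_sum_blocks π (Finset.filter_subset _ _)
          (G := fun k q => 16 * blockMajorant ν p B k ((seqShift (2 ^ k))^[q] x))
          (fun k q => mul_nonneg (by norm_num) (blockMajorant_nonneg _ _ _ _ _)) ?_
        intro a b hmem hab hbN
        exact intervalSum_sq_le_blockMajorant hB hN hab hbN x (Finset.mem_filter.1 hmem).2
    _ ≤ ∑ k ∈ Finset.range (Nat.log 2 N + 1), 32 * C * N * (1 / ((k : ℝ) + 1) ^ 2) := by
        refine Finset.sum_le_sum fun k hk => ?_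
        have hkN : 2 ^ k ≤ N :=
          Nat.pow_le_of_le_log (by lia) (Nat.lt_succ_iff.1 (Finset.mem_range.1 hk))
        -- The extra, possibly incomplete block costs `2^k ≤ N`.
        have hlen : (2 : ℝ) ^ k * ((N / 2 ^ k + 1 : ℕ) : ℝ) ≤ 2 * N := by
          have : 2 ^ k * (N / 2 ^ k + 1) ≤ 2 * N := by
            have := Nat.mul_div_le N (2 ^ k)
            rw [mul_add, mul_one]
            lia
          exact_mod_cast this
        rw [← Finset.mul_sum]
        have h := hx k (N / 2 ^ k + 1)
        rw [birkhoffSum] at h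
        calc _ ≤ 16 * (C * (2 ^ k / ((k : ℝ) + 1) ^ 2) * ((N / 2 ^ k + 1 : ℕ) : ℝ)) := by gcongr
          _ = 16 * C * (1 / ((k : ℝ) + 1) ^ 2) * (2 ^ k * ((N / 2 ^ k + 1 : ℕ) : ℝ)) := by ring
          _ ≤ 16 * C * (1 / ((k : ℝ) + 1) ^ 2) * (2 * N) := by gcongr
          _ = _ := by ring
    _ = 32 * C * N * ∑ k ∈ Finset.range (Nat.log 2 N + 1), 1 / ((k : ℝ) + 1) ^ 2 := by
        rw [Finset.mul_sum]
    _ ≤ 32 * C * N * ∑' k : ℕ, 1 / ((k : ℝ) + 1) ^ 2 := by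
        gcongr
        exact summable_one_div_succ_sq.sum_le_tsum _ fun k _ => by positivity
    _ = _ := by ring

/-- Almost surely the contribution of the bad intervals is `O(N)`, uniformly over all partitions. -/
theorem ae_badContribution_le {ν : Measure ℝ} [IsProbabilityMeasure ν] {p B : ℝ} (hp : 2 < p)
    (hB : 1152 ≤ B) (h2 : MemLp (fun y => y) 2 ν) (h0 : ∫ y, y ∂ν = 0) (h21 : ∫ y, y ^ 2 ∂ν ≤ 1)
    (hint : Integrable (fun y => |y| ^ p) ν) :
    ∀ᵐ x ∂Measure.infinitePi (fun _ : ℕ => ν), ∃ C : ℝ, ∀ N : ℕ, 3 ≤ N →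
      ∀ π : IntervalPartition N, badContribution B x π ≤ C * N := by
  filter_upwards [ae_exists_forall_birkhoffSum_le
    (fun k => measurePreserving_seqShift ν (2 ^ k)) (measurable_blockMajorant ν p B)
    (integrable_blockMajorant h2 p B) (blockMajorant_nonneg ν p B)
    (w := fun k : ℕ => 2 ^ k / ((k : ℝ) + 1) ^ 2) (fun k => by positivity)
    (summable_integral_blockMajorant hp hB h2 h0 h21 hint)] with x ⟨C, hC, hx⟩
  exact ⟨_, fun N hN π => badContribution_le (by linarith) hC hx hN π⟩

end BadIntervals

/-! ### Transfer to the given random variables. -/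

theorem badContribution_nonneg (B : ℝ) (x : ℕ → ℝ) {N : ℕ} (π : IntervalPartition N) :
    0 ≤ badContribution B x π :=
  Finset.sum_nonneg fun _ _ => sq_nonneg _

theorem mainTheorem3 {Ω : Type*} [MeasurableSpace Ω] (μ : Measure Ω) [IsProbabilityMeasure μ]
    (X : ℕ → Ω → ℝ) (hmeas : ∀ i, Measurable (X i))
    (hindep : iIndepFun X μ) (hident : ∀ i, IdentDistrib (X i) (X 0) μ μ)
    (hmean : ∫ ω, X 0 ω ∂μ = 0) (hvar : variance (X 0) μ = 1)
    (δ : ℝ) (hδ : 0 < δ)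
    (hmoment : Integrable (fun ω => |X 0 ω| ^ (2 * (1 + δ))) μ)
    (B : ℝ) (hB : B / 576 * (1 - 1 / (1 + δ)) - 1 > 1) :
    ∀ᵐ ω ∂μ, ∀ π : (N : ℕ) → IntervalPartition N,
      (∀ N, IsMaximalPartition (fun i => X i ω) (π N)) →
      Tendsto (fun N : ℕ => badContribution B (fun i => X i ω) (π N) /
        ((N : ℝ) * Real.log (Real.log (N : ℝ)))) atTop (𝓝 0) := by
  -- The hypothesis reads `B (1 - 1/(1+δ)) > 2 * 576`, with a factor in `(0, 1)`.
  have hB' : 1152 ≤ B := by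
    have h1 : 0 < 1 / (1 + δ) := by positivity
    have h2 : 1 / (1 + δ) < 1 := by
      rw [div_lt_one (by linarith)]
      linarith
    by_contra hlt
    nlinarith
  have hmap : μ.map (fun ω i => X i ω) = Measure.infinitePi fun _ : ℕ => μ.map (X 0) := by
    rw [hindep.map_fun_eq_infinitePi_map hmeas]
    congr 1
    ext1 i
    exact (hident i).map_eq
  have : IsProbabilityMeasure (μ.map (X 0)) :=
    Measure.isProbabilityMeasure_map (hmeas 0).aemeasurable
  -- Outside `L²` the real-valued `variance` is 0 by convention, so `hvar` forces square
  -- integrability.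
  have hL2 : MemLp (X 0) 2 μ := by
    by_contra h
    rw [variance_of_not_memLp (hmeas 0).aestronglyMeasurable h] at hvar
    exact zero_ne_one hvar
  have hsq : ∫ ω, X 0 ω ^ 2 ∂μ = 1 := by
    rw [variance_eq_sub hL2, hmean] at hvar
    simpa using hvar
  have hae := ae_badContribution_le (ν := μ.map (X 0)) (p := 2 * (1 + δ)) (B := B) (by linarith) hB'
    ((memLp_map_measure_iff (by fun_prop) (hmeas 0).aemeasurable).2 hL2)
    (by rw [integral_map (hmeas 0).aemeasurable (by fun_prop), hmean])
    (by rw [integral_map (hmeas 0).aemeasurable (by fun_prop), hsq])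
    ((integrable_map_measure (Measurable.aestronglyMeasurable (by fun_prop))
      (hmeas 0).aemeasurable).2 hmoment)
  rw [← hmap] at hae
  filter_upwards [ae_of_ae_map (measurable_pi_iff.2 hmeas).aemeasurable hae] with ω ⟨C, hC⟩ π _
  have hloglog : Tendsto (fun N : ℕ => Real.log (Real.log N)) atTop atTop :=
    Real.tendsto_log_atTop.comp (Real.tendsto_log_atTop.comp tendsto_natCast_atTop_atTop)
  refine squeeze_zero' ?_ ?_ ((tendsto_const_nhds (x := C)).div_atTop hloglog)
  · filter_upwards [hloglog.eventually_ge_atTop 0] with N hN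
    exact div_nonneg (badContribution_nonneg _ _ _) (by positivity)
  · filter_upwards [hloglog.eventually_gt_atTop 0, eventually_ge_atTop 3] with N hl hN
    have hN' : (0 : ℝ) < N := by exact_mod_cast (show 0 < N by lia)
    rw [div_le_div_iff₀ (by positivity) hl]
    calc _ ≤ C * N * Real.log (Real.log N) := by gcongr; exact hC N hN (π N)
      _ = _ := by ring
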